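/- A directed graph is a structure with one binary relation that is irreflexive and antisymmetric (no edges in both directions). For $n\in\{2,3,\ldots\}\cup\{\omega\}$, an $n$-partite tournament is a directed graph whose vertex set can be partitioned into $n$ (possibly empty) parts (countably infinitely many parts, indexed by $\omega$, if $n=\omega$) such that any two vertices in different parts are joined by an edge and there are no edges between vertices in the same part. The Fraïssé limit of a class $\mathcal C$ of finite structures is the countable homogeneous structure, unique up to isomorphism, whose age (the class of all finite structures that embed into it) is $\mathcal C$. For a countable structure $M$, equip $G=\mathrm{Aut}(M)$ with the topology of pointwise convergence ($M$ discrete) and, for an integer $k\ge 1$, $G^k$ with the product topology; $M$ has $k$-generic automorphisms if the action $g\cdot(h_1,\ldots,h_k)=(gh_1g^{-1},\ldots,gh_kg^{-1})$ of $G$ on $G^k$ has a comeagre orbit, and $M$ has ample generics if it has $k$-generic automorphisms for every $k\ge 1$. **Theorem 1.4.** The Fraïssé limit of the class of all finite $\omega$-partite tournaments exists and has ample generics. For every $n\in\{2,3,\ldots\}$, the Fraïssé limit of the class of all finite $n$-partite tournaments exists and does not have $1$-generic automorphisms. In fact, its automorphism group does not even have a dense conjugacy class. -/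

import Mathlib

universe u

open scoped FirstOrder

namespace PartiteTournament

open FirstOrder FirstOrder.Language

/-- The automorphisms of a first-order structure form a group under composition,
`(g * h) x = g (h x)`. -/
instance autGroup {L : FirstOrder.Language} (M : Type u) [L.Structure M] : Group (M ≃[L] M) where
  mul g h := g.comp h
  one := FirstOrder.Language.Equiv.refl L M
  inv g := g.symm
  mul_assoc _ _ _ := rfl
  one_mul _ := rfl
  mul_one _ := rfl
  inv_mul_cancel g := FirstOrder.Language.Equiv.symm_comp_self g

/-- The topology of pointwise convergence on the automorphism group: the topology induced from the
product topology on `M → M`, where `M` is discrete. -/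
instance autTopology {L : FirstOrder.Language} (M : Type u) [L.Structure M] : TopologicalSpace (M ≃[L] M) :=
  TopologicalSpace.induced (fun g => (g : M → M)) (@Pi.topologicalSpace M (fun _ => M) (fun _ => ⊥))

/-- The orbit of the tuple `h` under the action of `G` on `Gⁿ` by diagonal conjugation,
`g • (h₁, …, hₙ) = (g h₁ g⁻¹, …, g hₙ g⁻¹)`. -/
def diagonalConjOrbit {G : Type*} [Group G] {n : ℕ} (h : Fin n → G) : Set (Fin n → G) :=
  Set.range fun (g : G) (i : Fin n) => g * h i * g⁻¹

/-- `M` has `n`-generic automorphisms: `Aut(M)` has a comeagre orbit on `Aut(M)ⁿ` (with the product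
topology) in its action by diagonal conjugation. -/
def HasGenericAutomorphisms (L : FirstOrder.Language) (M : Type u) [L.Structure M] (n : ℕ) : Prop :=
  ∃ h : Fin n → (M ≃[L] M), diagonalConjOrbit h ∈ residual (Fin n → (M ≃[L] M))

/-- `M` has ample generics: it has `n`-generic automorphisms for every `n ≥ 1`. -/
def HasAmpleGenerics (L : FirstOrder.Language) (M : Type u) [L.Structure M] : Prop :=
  ∀ n : ℕ, 1 ≤ n → HasGenericAutomorphisms L M n

/-- The group `G` has a dense conjugacy class. -/
def HasDenseConjClass (G : Type*) [Group G] [TopologicalSpace G] : Prop :=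
  ∃ g : G, Dense (conjugatesOf g)

/-- `Edge x y`: there is an edge going from `x` to `y`. The language `Language.graph` consists of
a single binary relation symbol (with no axioms, in particular no symmetry). -/
def Edge {A : Type u} [Language.graph.Structure A] (x y : A) : Prop :=
  Structure.RelMap Language.adj ![x, y]

/-- `A` is a tournament with (possibly empty) parts indexed by `ι`: the edge relation is irreflexive
and antisymmetric (no edges in both directions), and there is a partition of the vertex set into
parts, given by `part`, such that any two vertices in different parts are joined by an edge and
there are no edges between vertices in the same part. -/
def IsPartiteTournament (ι : Type) (A : Type u) [Language.graph.Structure A] : Prop :=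
  (∀ x : A, ¬ Edge x x) ∧
  (∀ x y : A, Edge x y → ¬ Edge y x) ∧
  ∃ part : A → ι,
    (∀ x y : A, part x ≠ part y → Edge x y ∨ Edge y x) ∧
    (∀ x y : A, part x = part y → ¬ Edge x y)

/-- The class of all finite tournaments with parts indexed by `ι`. The finite `n`-partite
tournaments are obtained for `ι = Fin n`, the finite `ω`-partite tournaments for `ι = ℕ`. -/
def finitePartiteTournaments (ι : Type) : Set (CategoryTheory.Bundled.{u} Language.graph.Structure) :=
  {A | Finite A ∧ IsPartiteTournament ι A}

end PartiteTournament

/-! Ample generics come from a back-and-forth. Two tuples of automorphisms that are both locally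
finite and saturated are conjugate (`exists_conj_of_isSaturated`), so if such tuples are comeagre,
one orbit is comeagre. They are comeagre once finite partial data extend to finite systems
(`extendsToLocallyFinite`) and finite systems amalgamate over a common subsystem
(`amalgamatesSystems`).

The first property is the extension property for partial automorphisms, proved with Boolean
valuations that reverse orientations (`exists_extension_partial_automorphisms`). For the second,
parts of the two systems are identified only where they meet the common subsystem, and all remaining
cross edges point the same way. This recipe is canonical, hence invariant under the systems, but it
can create new parts, so infinitely many must be available.

With finitely many parts, at least two, preserving every part is a conjugation-invariant property.
It holds on a nonempty open set and fails on another, so no conjugacy class is dense.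

The limits exist because a countable partite tournament realizing all one-point extensions can be
coded on `ι × ℕ`, as for the random graph. -/

namespace PartiteTournament

open FirstOrder FirstOrder.Language Topology

/-! ### Pointwise convergence on automorphism groups -/

section Automorphisms

variable {L : FirstOrder.Language} {M : Type u} [L.Structure M]

@[simp] lemma aut_mul_apply (g h : M ≃[L] M) (x : M) : (g * h) x = g (h x) := rfl

@[simp] lemma aut_one_apply (x : M) : (1 : M ≃[L] M) x = x := rfl

@[simp] lemma aut_inv_apply_self (g : M ≃[L] M) (x : M) : g⁻¹ (g x) = x :=
  g.symm_apply_apply x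

@[simp] lemma aut_apply_inv_self (g : M ≃[L] M) (x : M) : g (g⁻¹ x) = x :=
  g.apply_symm_apply x

/-- A pair of maps that is approximated on finite sets by automorphisms and their inverses
is an automorphism and its inverse. -/
lemma exists_aut_of_approx (f h : M → M)
    (H : ∀ T : Finset M, ∃ g : M ≃[L] M, (∀ x ∈ T, g x = f x) ∧ ∀ x ∈ T, g⁻¹ x = h x) :
    ∃ g : M ≃[L] M, (∀ x, g x = f x) ∧ ∀ x, g⁻¹ x = h x := by
  classical
  have hfh : ∀ x, f (h x) = x := fun x => by
    obtain ⟨g, h1, h2⟩ := H {x, h x}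
    rw [← h1 (h x) (by simp), ← h2 x (by simp), aut_apply_inv_self]
  have hhf : ∀ x, h (f x) = x := fun x => by
    obtain ⟨g, h1, h2⟩ := H {x, f x}
    rw [← h2 (f x) (by simp), ← h1 x (by simp), aut_inv_apply_self]
  refine ⟨⟨⟨f, h, hhf, hfh⟩, ?_, ?_⟩, fun _ => rfl, fun _ => rfl⟩
  · intro n c v
    obtain ⟨g, h1, -⟩ := H (insert (Structure.funMap c v) (Finset.univ.image v))
    have hv : f ∘ v = g ∘ v := funext fun i => (h1 _ (by simp)).symm
    change f _ = Structure.funMap c (f ∘ v)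
    rw [hv, ← h1 _ (by simp)]
    exact g.map_fun c v
  · intro n r v
    obtain ⟨g, h1, -⟩ := H (Finset.univ.image v)
    have hv : f ∘ v = g ∘ v := funext fun i => (h1 _ (by simp)).symm
    change Structure.RelMap r (f ∘ v) ↔ _
    rw [hv]
    exact g.map_rel r v

lemma isOpen_setOf_apply_eq (x y : M) : IsOpen {g : M ≃[L] M | g x = y} := by
  let _ : TopologicalSpace M := ⊥
  have : DiscreteTopology M := ⟨rfl⟩
  have h : IsOpen ((fun f : M → M => f x) ⁻¹' {y}) :=
    (isOpen_discrete {y}).preimage (continuous_apply x)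
  exact ⟨_, h, rfl⟩

lemma isOpen_setOf_tuple_apply_eq {n : ℕ} (i : Fin n) (x y : M) :
    IsOpen {g : Fin n → (M ≃[L] M) | g i x = y} :=
  (isOpen_setOf_apply_eq x y).preimage
    (continuous_apply (A := fun _ : Fin n => M ≃[L] M) i)

lemma exists_finset_of_mem_nhds {g : M ≃[L] M} {U : Set (M ≃[L] M)} (hU : U ∈ 𝓝 g) :
    ∃ T : Finset M, ∀ g' : M ≃[L] M, (∀ x ∈ T, g' x = g x) → g' ∈ U := by
  let _ : TopologicalSpace M := ⊥
  have : DiscreteTopology M := ⟨rfl⟩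
  rw [nhds_induced, nhds_pi, Filter.mem_comap] at hU
  obtain ⟨t, ht, htU⟩ := hU
  obtain ⟨I, hI, s, hs, hst⟩ := Filter.mem_pi.1 ht
  refine ⟨hI.toFinset, fun g' hg' => htU (hst ?_)⟩
  intro x hx
  change g' x ∈ s x
  rw [hg' x (by simpa using hx)]
  exact mem_of_mem_nhds (hs x)

lemma exists_finset_of_mem_nhds_tuple {n : ℕ} {g : Fin n → (M ≃[L] M)}
    {U : Set (Fin n → (M ≃[L] M))} (hU : U ∈ 𝓝 g) :
    ∃ T : Finset M, ∀ g' : Fin n → (M ≃[L] M), (∀ i, ∀ x ∈ T, g' i x = g i x) → g' ∈ U := by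
  classical
  rw [nhds_pi] at hU
  obtain ⟨I, -, s, hs, hst⟩ := Filter.mem_pi.1 hU
  choose T hT using fun i => exists_finset_of_mem_nhds (hs i)
  refine ⟨Finset.univ.biUnion T, fun g' hg' => hst fun i _ => hT i _ fun x hx => hg' i x ?_⟩
  exact Finset.mem_biUnion.2 ⟨i, Finset.mem_univ i, hx⟩

lemma dense_of_forall_finset {n : ℕ} {S : Set (Fin n → (M ≃[L] M))}
    (H : ∀ (g : Fin n → (M ≃[L] M)) (T : Finset M), ∃ g' ∈ S, ∀ i, ∀ x ∈ T, g' i x = g i x) :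
    Dense S := by
  intro g
  rw [mem_closure_iff_nhds]
  intro U hU
  obtain ⟨T, hT⟩ := exists_finset_of_mem_nhds_tuple hU
  obtain ⟨g', hg', h⟩ := H g T
  exact ⟨g', hT g' h, hg'⟩

/-- The automorphism group of a countable structure is Polish. -/
instance polishSpace_aut [Countable M] : PolishSpace (M ≃[L] M) := by
  classical
  let _ : TopologicalSpace M := ⊥
  have : DiscreteTopology M := ⟨rfl⟩
  -- Recording the inverse makes the image closed: a pointwise limit of automorphisms alone need not
  -- be surjective.
  let e : (M ≃[L] M) → (M → M) × (M → M) :=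
    fun g => (g, (g⁻¹ : M ≃[L] M))
  have h1 : Continuous (fun g : M ≃[L] M => (g : M → M)) := continuous_induced_dom
  have h2 : Continuous (fun g : M ≃[L] M => ((g⁻¹ : M ≃[L] M) : M → M)) := by
    refine continuous_pi fun x => continuous_discrete_rng.2 fun y => ?_
    convert isOpen_setOf_apply_eq (L := L) y x using 1
    ext g
    constructor
    · rintro (rfl : g⁻¹ x = y)
      exact aut_apply_inv_self g x
    · rintro (rfl : g y = x)
      exact aut_inv_apply_self g y
  have h3 : Continuous e := h1.prodMk h2
  have he : IsClosedEmbedding e := by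
    refine ⟨⟨⟨le_antisymm h3.le_induced ?_⟩, ?_⟩, ?_⟩
    · change TopologicalSpace.induced e _ ≤ TopologicalSpace.induced (Prod.fst ∘ e) _
      rw [← induced_compose]
      exact induced_mono continuous_fst.le_induced
    · intro g g' h
      exact DFunLike.coe_injective (congrArg Prod.fst h)
    · rw [← closure_subset_iff_isClosed]
      rintro ⟨f, h⟩ hfh
      obtain ⟨g, hg, hg'⟩ := exists_aut_of_approx (L := L) f h fun T => by
        have hU : {p : (M → M) × (M → M) | (∀ x ∈ T, p.1 x = f x) ∧ ∀ x ∈ T, p.2 x = h x}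
            ∈ 𝓝 (f, h) := by
          refine IsOpen.mem_nhds ?_ (by simp)
          simp only [Set.ofPred_and, Set.ofPred_forall]
          refine IsOpen.inter ?_ ?_
          · refine isOpen_biInter_finset fun x _ => (isOpen_discrete {f x}).preimage ?_
            fun_prop
          · refine isOpen_biInter_finset fun x _ => (isOpen_discrete {h x}).preimage ?_
            fun_prop
        obtain ⟨_, hp, g, rfl⟩ := mem_closure_iff_nhds.1 hfh _ hU
        exact ⟨g, hp⟩
      exact ⟨g, Prod.ext (funext hg) (funext hg')⟩
  have : PolishSpace M := inferInstance
  have : PolishSpace (M → M) := inferInstance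
  exact he.polishSpace

end Automorphisms

/-! ### A back-and-forth criterion for generic tuples -/

section GenericTuples

variable {L : FirstOrder.Language} {M : Type u} [L.Structure M] {n : ℕ}

/-- The finite set `A` is mapped to itself by all members of the tuple `g`. -/
def IsInvariant (g : Fin n → (M ≃[L] M)) (A : Finset M) : Prop :=
  ∀ i, ∀ x ∈ A, g i x ∈ A

/-- Every finite set is contained in a finite invariant set. -/
def IsLocallyFinite (g : Fin n → (M ≃[L] M)) : Prop :=
  ∀ T : Finset M, ∃ A, T ⊆ A ∧ IsInvariant g A

/-- The system `(B, β)`, in which `A` is a subsystem of `g`, is realized in `g` over `A`. -/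
def Realizes (A B : Finset M) (β g : Fin n → (M ≃[L] M)) : Prop :=
  ∃ φ : M ≃[L] M, (∀ x ∈ A, φ x = x) ∧ ∀ i, ∀ x ∈ B, φ (β i x) = g i (φ x)

/-- Every finite system over a finite subsystem of `g` is realized in `g`. -/
def IsSaturated (g : Fin n → (M ≃[L] M)) : Prop :=
  ∀ (A B : Finset M) (β : Fin n → (M ≃[L] M)), A ⊆ B → IsInvariant β A → IsInvariant β B →
    (∀ i, ∀ x ∈ A, g i x = β i x) → Realizes A B β g

/-- Finite systems with a common subsystem can be amalgamated in `M`. -/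
def AmalgamatesSystems (L : FirstOrder.Language) (M : Type u) [L.Structure M] (n : ℕ) : Prop :=
  ∀ (g β : Fin n → (M ≃[L] M)) (A B C : Finset M), A ⊆ B → A ⊆ C →
    IsInvariant β A → IsInvariant β B → IsInvariant g C → (∀ i, ∀ x ∈ A, g i x = β i x) →
    ∃ g' : Fin n → (M ≃[L] M), (∀ i, ∀ x ∈ C, g' i x = g i x) ∧ Realizes A B β g'

/-- Finite parts of tuples of automorphisms extend to tuples with a finite invariant set. -/
def ExtendsToLocallyFinite (L : FirstOrder.Language) (M : Type u) [L.Structure M] (n : ℕ) : Prop :=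
  ∀ (g : Fin n → (M ≃[L] M)) (T : Finset M), ∃ (g' : Fin n → (M ≃[L] M)) (A : Finset M),
    (∀ i, ∀ x ∈ T, g' i x = g i x) ∧ T ⊆ A ∧ IsInvariant g' A

lemma isOpen_setOf_agree (A : Finset M) (β : Fin n → (M ≃[L] M)) :
    IsOpen {g : Fin n → (M ≃[L] M) | ∀ i, ∀ x ∈ A, g i x = β i x} := by
  simp only [Set.ofPred_forall]
  exact isOpen_iInter_of_finite fun i => isOpen_biInter_finset fun x _ =>
    isOpen_setOf_tuple_apply_eq i x _

lemma isOpen_of_forall_agree {S : Set (Fin n → (M ≃[L] M))}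
    (H : ∀ g ∈ S, ∃ A : Finset M, ∀ g' : Fin n → (M ≃[L] M),
      (∀ i, ∀ x ∈ A, g' i x = g i x) → g' ∈ S) : IsOpen S := by
  rw [isOpen_iff_mem_nhds]
  intro g hg
  obtain ⟨A, hA⟩ := H g hg
  exact Filter.mem_of_superset ((isOpen_setOf_agree A g).mem_nhds fun _ _ _ => rfl) hA

lemma isOpen_setOf_exists_isInvariant (T : Finset M) :
    IsOpen {g : Fin n → (M ≃[L] M) | ∃ A, T ⊆ A ∧ IsInvariant g A} := by
  refine isOpen_of_forall_agree ?_
  rintro g ⟨A, hTA, hA⟩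
  exact ⟨A, fun g' h => ⟨A, hTA, fun i x hx => by rw [h i x hx]; exact hA i x hx⟩⟩

/-- A realization by `φ` involves only the values of `g` on `φ(B)`, and disagreement with `β` on `A`
involves only the values on `A`. -/
lemma isOpen_setOf_agree_imp_realizes (A B : Finset M) (β : Fin n → (M ≃[L] M)) :
    IsOpen {g : Fin n → (M ≃[L] M) | (∀ i, ∀ x ∈ A, g i x = β i x) → Realizes A B β g} := by
  classical
  refine isOpen_of_forall_agree ?_
  intro g hg
  by_cases h : ∀ i, ∀ x ∈ A, g i x = β i x
  · obtain ⟨φ, h1, h2⟩ := hg h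
    refine ⟨B.image φ, fun g' h' _ => ⟨φ, h1, fun i x hx => ?_⟩⟩
    rw [h2 i x hx, h' i _ (Finset.mem_image_of_mem φ hx)]
  · refine ⟨A, fun g' h' h'' => absurd (fun i x hx => ?_) h⟩
    rw [← h' i x hx, h'' i x hx]

lemma residual_isLocallyFinite [Countable M] (hE : ExtendsToLocallyFinite L M n) :
    {g : Fin n → (M ≃[L] M) | IsLocallyFinite g} ∈ residual (Fin n → (M ≃[L] M)) := by
  classical
  have : {g : Fin n → (M ≃[L] M) | IsLocallyFinite g} =
      ⋂ T : Finset M, {g | ∃ A, T ⊆ A ∧ IsInvariant g A} := by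
    ext g; simp [IsLocallyFinite]
  rw [this, countable_iInter_mem]
  intro T
  refine residual_of_dense_open (isOpen_setOf_exists_isInvariant T)
    (dense_of_forall_finset fun g S => ?_)
  obtain ⟨g', A, h1, h2, h3⟩ := hE g (S ∪ T)
  exact ⟨g', ⟨A, Finset.union_subset_right h2, h3⟩,
    fun i x hx => h1 i x (Finset.mem_union_left _ hx)⟩

lemma residual_isSaturated [Countable M] (hE : ExtendsToLocallyFinite L M n)
    (hA : AmalgamatesSystems L M n) :
    {g : Fin n → (M ≃[L] M) | IsSaturated g} ∈ residual (Fin n → (M ≃[L] M)) := by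
  classical
  -- There may be uncountably many `β`, but only `β` on the finite set `B` matters, so a countable
  -- dense set of tuples suffices.
  obtain ⟨Q, hQc, hQd⟩ := TopologicalSpace.exists_countable_dense (Fin n → (M ≃[L] M))
  have := hQc.to_subtype
  have hsub : (⋂ p : Finset M × Finset M × Q,
      {g | p.1 ⊆ p.2.1 → IsInvariant p.2.2.1 p.1 → IsInvariant p.2.2.1 p.2.1 →
        (∀ i, ∀ x ∈ p.1, g i x = p.2.2.1 i x) → Realizes p.1 p.2.1 p.2.2.1 g}) ⊆
      {g : Fin n → (M ≃[L] M) | IsSaturated g} := by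
    intro g hg A B β hAB hβA hβB hgβ
    obtain ⟨q, hqB, hqQ⟩ := hQd.inter_open_nonempty _ (isOpen_setOf_agree B β)
      ⟨β, fun _ _ _ => rfl⟩
    have hq : ∀ i, ∀ x ∈ B, q i x = β i x := hqB
    obtain ⟨φ, h1, h2⟩ := Set.mem_iInter.1 hg (A, B, ⟨q, hqQ⟩) hAB
      (fun i x hx => by rw [hq i x (hAB hx)]; exact hβA i x hx)
      (fun i x hx => by rw [hq i x hx]; exact hβB i x hx)
      (fun i x hx => by rw [hq i x (hAB hx)]; exact hgβ i x hx)
    exact ⟨φ, h1, fun i x hx => by rw [← hq i x hx]; exact h2 i x hx⟩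
  refine Filter.mem_of_superset (countable_iInter_mem.2 ?_) hsub
  rintro ⟨A, B, β, -⟩
  by_cases h : A ⊆ B ∧ IsInvariant β A ∧ IsInvariant β B
  · obtain ⟨hAB, hβA, hβB⟩ := h
    simp only [hAB, hβA, hβB, true_imp_iff]
    refine residual_of_dense_open (isOpen_setOf_agree_imp_realizes A B β)
      (dense_of_forall_finset fun g T => ?_)
    -- Replace `g` by a tuple with a finite invariant set containing `T` and `A`. Either it
    -- disagrees with `β` on `A`, and the condition is vacuous, or the two systems amalgamate.
    obtain ⟨g₁, C, h1, h2, h3⟩ := hE g (T ∪ A)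
    by_cases hg₁ : ∀ i, ∀ x ∈ A, g₁ i x = β i x
    · obtain ⟨g₂, h4, h5⟩ := hA g₁ β A B C hAB (Finset.union_subset_right h2) hβA hβB h3 hg₁
      refine ⟨g₂, fun _ => h5, fun i x hx => ?_⟩
      rw [h4 i x (Finset.union_subset_left h2 hx), h1 i x (Finset.mem_union_left _ hx)]
    · exact ⟨g₁, fun h => absurd h hg₁, fun i x hx => h1 i x (Finset.mem_union_left _ hx)⟩
  · convert Filter.univ_mem
    ext g
    simp only [Set.mem_ofPred_eq, Set.mem_univ, iff_true]
    exact fun a b c => absurd ⟨a, b, c⟩ h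

/-- A finite approximation to a conjugacy between the tuples `g` and `h`. -/
structure PartialConj (g h : Fin n → (M ≃[L] M)) where
  /-- the automorphism whose restriction is considered -/
  map : M ≃[L] M
  /-- the domain of the approximation -/
  dom : Finset M
  invariant : IsInvariant g dom
  conj : ∀ i, ∀ x ∈ dom, map (g i x) = h i (map x)

namespace PartialConj

variable {g h : Fin n → (M ≃[L] M)}

/-- `q` extends `p`. -/
def Extends (p q : PartialConj g h) : Prop :=
  p.dom ⊆ q.dom ∧ ∀ x ∈ p.dom, q.map x = p.map x

lemma Extends.trans {p q r : PartialConj g h} (h₁ : p.Extends q) (h₂ : q.Extends r) :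
    p.Extends r :=
  ⟨h₁.1.trans h₂.1, fun x hx => (h₂.2 x (h₁.1 hx)).trans (h₁.2 x hx)⟩

/-- The inverse of a finite approximation. -/
def symm [DecidableEq M] (p : PartialConj g h) : PartialConj h g where
  map := p.map⁻¹
  dom := p.dom.image p.map
  invariant i y hy := by
    obtain ⟨x, hx, rfl⟩ := Finset.mem_image.1 hy
    rw [← p.conj i x hx]
    exact Finset.mem_image_of_mem _ (p.invariant i x hx)
  conj i y hy := by
    obtain ⟨x, hx, rfl⟩ := Finset.mem_image.1 hy
    rw [← p.conj i x hx, aut_inv_apply_self, aut_inv_apply_self]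

/-- Conjugating `g` by `p.map` turns a larger finite subsystem of `g` into a system extending a
subsystem of `h`; saturation realizes it, and composing with `p.map` gives the extension. -/
lemma exists_extends_mem_dom (hg : IsLocallyFinite g) (hh : IsSaturated h)
    (p : PartialConj g h) (m : M) : ∃ q : PartialConj g h, p.Extends q ∧ m ∈ q.dom := by
  classical
  obtain ⟨A, hA, hgA⟩ := hg (insert m p.dom)
  have hpA : p.dom ⊆ A := (Finset.subset_insert _ _).trans hA
  obtain ⟨ψ, h1, h2⟩ := hh (p.dom.image p.map) (A.image p.map)
    (fun i => p.map * g i * p.map⁻¹) (Finset.image_subset_image hpA)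
    (fun i y hy => by
      obtain ⟨x, hx, rfl⟩ := Finset.mem_image.1 hy
      simpa using p.invariant i x hx)
    (fun i y hy => by
      obtain ⟨x, hx, rfl⟩ := Finset.mem_image.1 hy
      simpa using hgA i x hx)
    (fun i y hy => by
      obtain ⟨x, hx, rfl⟩ := Finset.mem_image.1 hy
      simpa using (p.conj i x hx).symm)
  refine ⟨⟨ψ * p.map, A, hgA, fun i x hx => ?_⟩, ⟨hpA, fun x hx => ?_⟩,
    hA (Finset.mem_insert_self _ _)⟩
  · simpa using h2 i (p.map x) (Finset.mem_image_of_mem _ hx)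
  · exact h1 _ (Finset.mem_image_of_mem _ hx)

lemma exists_extends_mem_image (hh : IsLocallyFinite h) (hg : IsSaturated g)
    (p : PartialConj g h) (m : M) : ∃ q : PartialConj g h, p.Extends q ∧ q.map⁻¹ m ∈ q.dom := by
  classical
  obtain ⟨q, ⟨h1, h2⟩, h3⟩ := exists_extends_mem_dom hh hg p.symm m
  refine ⟨q.symm, ⟨fun x hx => ?_, fun x hx => ?_⟩, ?_⟩
  · have := h2 (p.map x) (Finset.mem_image_of_mem _ hx)
    refine Finset.mem_image.2 ⟨p.map x, h1 (Finset.mem_image_of_mem _ hx), ?_⟩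
    rw [this]; exact aut_inv_apply_self _ _
  · have := h2 (p.map x) (Finset.mem_image_of_mem _ hx)
    change q.map⁻¹ x = _
    have hx' : q.map (p.map x) = x := this.trans (aut_inv_apply_self _ _)
    conv_lhs => rw [← hx']
    exact aut_inv_apply_self _ _
  · exact Finset.mem_image.2 ⟨m, h3, rfl⟩

end PartialConj

theorem exists_conj_of_isSaturated [Countable M] {g h : Fin n → (M ≃[L] M)}
    (hg : IsLocallyFinite g) (hg' : IsSaturated g) (hh : IsLocallyFinite h)
    (hh' : IsSaturated h) : ∃ φ : M ≃[L] M, ∀ i, φ * g i * φ⁻¹ = h i := by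
  classical
  have step : ∀ (p : PartialConj g h) (o : Option M), ∃ q : PartialConj g h, p.Extends q ∧
      ∀ m ∈ o, m ∈ q.dom ∧ q.map⁻¹ m ∈ q.dom := by
    rintro p (_ | m)
    · exact ⟨p, ⟨subset_rfl, fun _ _ => rfl⟩, by simp⟩
    · obtain ⟨q, hq, hqm⟩ := p.exists_extends_mem_dom hg hh' m
      obtain ⟨r, hr, hrm⟩ := q.exists_extends_mem_image hh hg' m
      refine ⟨r, hq.trans hr, ?_⟩
      rintro _ ⟨⟩
      exact ⟨hr.1 hqm, hrm⟩
  choose next hnext hmem using step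
  have := Encodable.ofCountable M
  let s : ℕ → PartialConj g h := fun k => Nat.rec
    ⟨1, ∅, fun _ _ h => absurd h (Finset.notMem_empty _),
      fun _ _ h => absurd h (Finset.notMem_empty _)⟩
    (fun k p => next p (Encodable.decode k)) k
  have hs : ∀ k l, k ≤ l → (s k).Extends (s l) := by
    intro k l hkl
    induction l, hkl using Nat.le_induction with
    | base => exact ⟨subset_rfl, fun _ _ => rfl⟩
    | succ l _ ih => exact ih.trans (hnext _ _)
  -- Step `k` treats the element with code `k` and produces stage `k + 1`; from stage `K m` on, the
  -- image and preimage of `m` are fixed.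
  let K : M → ℕ := fun m => Encodable.encode m + 1
  have hK : ∀ m, m ∈ (s (K m)).dom ∧ (s (K m)).map⁻¹ m ∈ (s (K m)).dom := fun m =>
    hmem (s (Encodable.encode m)) (Encodable.decode (Encodable.encode m)) m (by simp)
  have hfwd : ∀ m k, m ∈ (s k).dom → (s k).map m = (s (K m)).map m := by
    intro m k hm
    rcases le_total k (K m) with hle | hle
    · exact ((hs _ _ hle).2 m hm).symm
    · exact (hs _ _ hle).2 m (hK m).1
  have hbwd : ∀ m k, K m ≤ k → (s k).map⁻¹ m = (s (K m)).map⁻¹ m := by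
    intro m k hle
    have := (hs _ _ hle).2 _ (hK m).2
    rw [aut_apply_inv_self] at this
    conv_lhs => rw [← this]
    exact aut_inv_apply_self _ _
  obtain ⟨φ, hφ, -⟩ := exists_aut_of_approx (L := L) (fun m => (s (K m)).map m)
    (fun m => (s (K m)).map⁻¹ m) fun T => ⟨(s (T.sup K)).map,
      fun m hm => hfwd m _ ((hs _ _ (Finset.le_sup hm)).1 (hK m).1),
      fun m hm => hbwd m _ (Finset.le_sup hm)⟩
  refine ⟨φ, fun i => ?_⟩
  have key : ∀ x, φ (g i x) = h i (φ x) := fun x => by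
    rw [hφ, hφ, ← hfwd _ (K x) ((s (K x)).invariant i x (hK x).1)]
    exact (s (K x)).conj i x (hK x).1
  refine DFunLike.ext _ _ fun x => ?_
  rw [aut_mul_apply, aut_mul_apply, key, aut_apply_inv_self]

/-- A countable structure has `n`-generic automorphisms if tuples of finite partial automorphisms
extend to finite systems and finite systems can be amalgamated. -/
theorem hasGenericAutomorphisms_of_amalgamatesSystems [Countable M]
    (hE : ExtendsToLocallyFinite L M n) (hA : AmalgamatesSystems L M n) :
    HasGenericAutomorphisms L M n := by
  have hres := Filter.inter_mem (residual_isLocallyFinite hE) (residual_isSaturated hE hA)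
  obtain ⟨g, hg, hg'⟩ := (dense_of_mem_residual hres).nonempty
  refine ⟨g, Filter.mem_of_superset hres ?_⟩
  rintro h ⟨hh, hh'⟩
  obtain ⟨φ, hφ⟩ := exists_conj_of_isSaturated hg hg' hh hh'
  exact ⟨φ, funext hφ⟩

end GenericTuples

/-! ### Structures with one binary relation -/

section Relations

/-- The structure on `A` with edge relation `R`. -/
@[reducible] def structureOfRel {A : Type*} (R : A → A → Prop) : Language.graph.Structure A where
  RelMap | .adj => fun x => R (x 0) (x 1)

/-- The structure induced on a finite subset. -/
instance structureFinset {M : Type u} [Language.graph.Structure M] (A : Finset M) :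
    Language.graph.Structure A :=
  structureOfRel fun x y => Edge (x : M) y

lemma edge_finset {M : Type u} [Language.graph.Structure M] {A : Finset M} (x y : A) :
    Edge x y ↔ Edge (x : M) y := Iff.rfl

variable {A : Type*} {B : Type*} [Language.graph.Structure A] [Language.graph.Structure B]

lemma relMap_comp_iff {f : A → B} (hf : ∀ x y, Edge (f x) (f y) ↔ Edge x y) {n : ℕ}
    (r : Language.graph.Relations n) (v : Fin n → A) :
    Structure.RelMap r (f ∘ v) ↔ Structure.RelMap r v := by
  cases r
  have h := hf (v 0) (v 1)
  unfold Edge at h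
  convert h using 2 <;>
  · ext i; fin_cases i <;> rfl

/-- An injective map preserving and reflecting edges is an embedding. -/
def embeddingOfEdge (f : A → B) (hi : Function.Injective f)
    (hf : ∀ x y, Edge (f x) (f y) ↔ Edge x y) : A ↪[Language.graph] B where
  toFun := f
  inj' := hi
  map_fun' c := isEmptyElim c
  map_rel' r v := relMap_comp_iff hf r v

lemma embedding_edge_iff (f : A ↪[Language.graph] B) (x y : A) :
    Edge (f x) (f y) ↔ Edge x y := by
  unfold Edge
  rw [← f.map_rel adj ![x, y] ]
  have : (f ∘ ![x, y]) = ![f x, f y] := by ext i; fin_cases i <;> rfl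
  rw [this]

lemma aut_edge_iff (g : A ≃[Language.graph] A) (x y : A) : Edge (g x) (g y) ↔ Edge x y :=
  embedding_edge_iff g.toEmbedding x y

/-- The inclusion of a finite subset. -/
def finsetEmbedding {M : Type u} [Language.graph.Structure M] (A : Finset M) :
    A ↪[Language.graph] M :=
  embeddingOfEdge (fun x => (x : M)) Subtype.coe_injective fun _ _ => Iff.rfl

/-- Being an `ι`-partite tournament is inherited along embeddings. -/
lemma IsPartiteTournament.of_embedding {ι : Type} (hB : IsPartiteTournament ι B)
    (f : A ↪[Language.graph] B) : IsPartiteTournament ι A := by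
  obtain ⟨h1, h2, part, h3, h4⟩ := hB
  refine ⟨fun x h => h1 (f x) ((embedding_edge_iff f _ _).2 h), fun x y h h' => h2 (f x) (f y)
    ((embedding_edge_iff f _ _).2 h) ((embedding_edge_iff f _ _).2 h'), part ∘ f,
    fun x y h => ?_, fun x y h h' => h4 (f x) (f y) h ((embedding_edge_iff f _ _).2 h')⟩
  simpa only [embedding_edge_iff] using h3 (f x) (f y) h

end Relations

/-! ### Homogeneity and relabelling of parts -/

section Homogeneous

variable {L : FirstOrder.Language} {M : Type u} [L.Structure M]

/-- In an ultrahomogeneous structure, any two embeddings of a finite structure are conjugate. -/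
lemma exists_aut_comp_embedding (hM : L.IsUltrahomogeneous M) {D : Type*} [L.Structure D]
    [Finite D] (f f' : D ↪[L] M) : ∃ g : M ≃[L] M, ∀ x, g (f x) = f' x := by
  obtain ⟨g, hg⟩ := hM f.toHom.range (Structure.FG.range Structure.FG.of_finite f.toHom)
    (f'.comp f.equivRange.symm.toEmbedding)
  refine ⟨g, fun x => ?_⟩
  have := DFunLike.congr_fun hg (f.equivRange x)
  simpa using this.symm

end Homogeneous

/-- Isomorphisms respect lying in a common part but not the labels of parts; this supplies the
relabelling. Correcting by one transposition at a time also works for infinite `ι`. -/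
lemma exists_perm_extend {α ι : Type*} (S : Finset α) (a b : α → ι)
    (h : ∀ x ∈ S, ∀ y ∈ S, a x = a y ↔ b x = b y) :
    ∃ σ : Equiv.Perm ι, ∀ x ∈ S, σ (a x) = b x := by
  classical
  induction S using Finset.induction_on with
  | empty => exact ⟨1, by simp⟩
  | insert z S _ ih =>
    obtain ⟨σ, hσ⟩ := ih fun x hx y hy =>
      h x (Finset.mem_insert_of_mem hx) y (Finset.mem_insert_of_mem hy)
    by_cases hz : ∃ x ∈ S, a x = a z
    · obtain ⟨x, hx, hxz⟩ := hz
      refine ⟨σ, (Finset.forall_mem_insert _ _ _).2 ⟨?_, hσ⟩⟩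
      rw [← hxz, hσ x hx]
      exact (h x (Finset.mem_insert_of_mem hx) z (Finset.mem_insert_self _ _)).1 hxz
    · push Not at hz
      refine ⟨Equiv.swap (σ (a z)) (b z) * σ, (Finset.forall_mem_insert _ _ _).2 ⟨by simp, ?_⟩⟩
      intro x hx
      rw [Equiv.Perm.mul_apply, Equiv.swap_apply_of_ne_of_ne, hσ x hx]
      · exact fun e => hz x hx (σ.injective e)
      · rw [hσ x hx]
        exact fun e => hz x hx
          ((h x (Finset.mem_insert_of_mem hx) z (Finset.mem_insert_self _ _)).2 e)

/-! ### The generic partite tournament and existence of the limit -/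

section GenericPartite

variable {ι : Type}

/-- A partition `part` witnessing that `A` is a partite tournament. -/
structure IsPartition {A : Type*} [Language.graph.Structure A] (part : A → ι) : Prop where
  asymm : ∀ x y : A, Edge x y → ¬ Edge y x
  ne_iff : ∀ x y : A, part x ≠ part y ↔ Edge x y ∨ Edge y x

lemma IsPartition.irrefl {A : Type*} [Language.graph.Structure A] {part : A → ι}
    (h : IsPartition part) (x : A) : ¬ Edge x x :=
  fun hx => h.asymm x x hx hx

lemma IsPartition.isPartiteTournament {A : Type*} [Language.graph.Structure A] {part : A → ι}
    (h : IsPartition part) : IsPartiteTournament ι A :=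
  ⟨fun x hx => h.asymm x x hx hx, h.asymm, part, fun x y => (h.ne_iff x y).1,
    fun x y hxy he => (h.ne_iff x y).2 (Or.inl he) hxy⟩

lemma IsPartiteTournament.exists_isPartition {A : Type*} [Language.graph.Structure A]
    (h : IsPartiteTournament ι A) : ∃ part : A → ι, IsPartition part := by
  obtain ⟨-, h2, part, h3, h4⟩ := h
  refine ⟨part, h2, fun x y => ⟨h3 x y, ?_⟩⟩
  rintro (h | h) e
  · exact h4 x y e h
  · exact h4 y x e.symm h

lemma IsPartition.comp_injective {κ : Type} {A : Type*} [Language.graph.Structure A]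
    {part : A → ι} (h : IsPartition part) {f : ι → κ} (hf : f.Injective) :
    IsPartition (f ∘ part) :=
  ⟨h.asymm, fun x y => by rw [← h.ne_iff]; exact hf.ne_iff⟩

lemma IsPartition.eq_iff {A B : Type*} [Language.graph.Structure A] [Language.graph.Structure B]
    {κ : Type} {part : A → ι} {part' : B → κ} (h : IsPartition part) (h' : IsPartition part')
    {x y : A} {x' y' : B} (h₁ : Edge x' y' ↔ Edge x y) (h₂ : Edge y' x' ↔ Edge y x) :
    part' x' = part' y' ↔ part x = part y := by
  rw [← not_iff_not]
  exact (h'.ne_iff x' y').trans ((or_congr h₁ h₂).trans (h.ne_iff x y).symm)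

/-- Every one-point extension of a finite set with a prescribed part is realized. -/
structure IsGenericPartition {M : Type*} [Language.graph.Structure M] (part : M → ι) : Prop
    extends IsPartition part where
  exists_witness : ∀ (i : ι) (F U V : Finset M), (∀ x ∈ U, part x ≠ i) → (∀ x ∈ V, part x ≠ i) →
    Disjoint U V →
    ∃ z, part z = i ∧ z ∉ F ∧ (∀ x ∈ U, Edge z x) ∧ ∀ x ∈ V, Edge x z

/-- A map whose restriction to `S` is an embedding preserving parts. -/
structure IsPartEmbeddingOn {N M : Type*} [Language.graph.Structure N] [Language.graph.Structure M]
    (ρ : N → ι) (π : M → ι) (S : Finset N) (f : N → M) : Prop where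
  injOn : Set.InjOn f S
  part_eq : ∀ x ∈ S, π (f x) = ρ x
  edge_iff : ∀ x ∈ S, ∀ y ∈ S, Edge (f x) (f y) ↔ Edge x y

lemma IsGenericPartition.exists_extension {N M : Type*} [Language.graph.Structure N]
    [Language.graph.Structure M] [DecidableEq N] {ρ : N → ι} {π : M → ι} (hρ : IsPartition ρ)
    (hπ : IsGenericPartition π) {S : Finset N} {f : N → M} (hf : IsPartEmbeddingOn ρ π S f)
    (m : N) : ∃ f' : N → M, (∀ x ∈ S, f' x = f x) ∧ IsPartEmbeddingOn ρ π (insert m S) f' := by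
  classical
  by_cases hm : m ∈ S
  · exact ⟨f, fun _ _ => rfl, by rwa [Finset.insert_eq_of_mem hm]⟩
  obtain ⟨z, hz1, hz2, hz3, hz4⟩ := hπ.exists_witness (ρ m) (S.image f)
    ((S.filter fun s => Edge m s).image f) ((S.filter fun s => Edge s m).image f)
    (by
      intro x hx
      simp only [Finset.mem_image, Finset.mem_filter] at hx
      obtain ⟨s, ⟨hs, he⟩, rfl⟩ := hx
      rw [hf.part_eq s hs]; exact (hρ.ne_iff _ _).2 (Or.inr he))
    (by
      intro x hx
      simp only [Finset.mem_image, Finset.mem_filter] at hx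
      obtain ⟨s, ⟨hs, he⟩, rfl⟩ := hx
      rw [hf.part_eq s hs]; exact (hρ.ne_iff _ _).2 (Or.inl he))
    (by
      rw [Finset.disjoint_left]
      intro x hx hx'
      simp only [Finset.mem_image, Finset.mem_filter] at hx hx'
      obtain ⟨s, ⟨hs, he⟩, rfl⟩ := hx
      obtain ⟨t, ⟨ht, he'⟩, hst⟩ := hx'
      rw [hf.injOn ht hs hst] at he'
      exact hρ.asymm _ _ he he')
  have hz3' : ∀ s ∈ S, Edge m s → Edge z (f s) := fun s hs he =>
    hz3 _ (Finset.mem_image_of_mem f (Finset.mem_filter.2 ⟨hs, he⟩))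
  have hz4' : ∀ s ∈ S, Edge s m → Edge (f s) z := fun s hs he =>
    hz4 _ (Finset.mem_image_of_mem f (Finset.mem_filter.2 ⟨hs, he⟩))
  have hne : ∀ s ∈ S, s ≠ m := fun s hs e => hm (e ▸ hs)
  have hS : ∀ s ∈ S, Function.update f m z s = f s := fun s hs =>
    Function.update_of_ne (hne s hs) _ _
  have hpart : ∀ s ∈ S, π z ≠ π (f s) → Edge m s ∨ Edge s m := fun s hs h => by
    rw [hz1, hf.part_eq s hs] at h
    exact (hρ.ne_iff _ _).1 h
  refine ⟨Function.update f m z, hS, ?_, ?_, ?_⟩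
  · intro x hx y hy hxy
    rw [Finset.mem_coe, Finset.mem_insert] at hx hy
    rcases hx with rfl | hx <;> rcases hy with rfl | hy
    · rfl
    · rw [Function.update_self, hS y hy] at hxy
      exact absurd (hxy ▸ Finset.mem_image_of_mem f hy) hz2
    · rw [Function.update_self, hS x hx] at hxy
      exact absurd (hxy ▸ Finset.mem_image_of_mem f hx) hz2
    · rw [hS x hx, hS y hy] at hxy
      exact hf.injOn hx hy hxy
  · rw [Finset.forall_mem_insert]
    exact ⟨by rw [Function.update_self, hz1], fun x hx => by rw [hS x hx, hf.part_eq x hx]⟩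
  · intro x hx y hy
    rw [Finset.mem_insert] at hx hy
    rcases hx with rfl | hx <;> rcases hy with rfl | hy
    · rw [Function.update_self]
      exact iff_of_false (hπ.irrefl _) (hρ.irrefl _)
    · rw [Function.update_self, hS y hy]
      refine ⟨fun h => ?_, hz3' y hy⟩
      refine (hpart y hy ((hπ.ne_iff _ _).2 (Or.inl h))).resolve_right fun h' => ?_
      exact hπ.asymm _ _ h (hz4' y hy h')
    · rw [Function.update_self, hS x hx]
      refine ⟨fun h => ?_, hz4' x hx⟩
      refine (hpart x hx ((hπ.ne_iff _ _).2 (Or.inr h))).resolve_left fun h' => ?_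
      exact hπ.asymm _ _ h (hz3' x hx h')
    · rw [hS x hx, hS y hy]
      exact hf.edge_iff x hx y hy

lemma IsGenericPartition.nonempty_embedding {N M : Type*} [Language.graph.Structure N]
    [Language.graph.Structure M] [Finite N] {ρ : N → ι} {π : M → ι} (hρ : IsPartition ρ)
    (hπ : IsGenericPartition π) : Nonempty (N ↪[Language.graph] M) := by
  classical
  have := Fintype.ofFinite N
  -- Nonemptiness provides a part, and hence a default value in `M`; both `ι` and `M` may be empty.
  have key : ∀ S : Finset N, S.Nonempty → ∃ f : N → M, IsPartEmbeddingOn ρ π S f := by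
    intro S hS
    obtain ⟨a, ha⟩ := hS
    obtain ⟨c, -⟩ := hπ.exists_witness (ρ a) ∅ ∅ ∅ (by simp) (by simp) (by simp)
    clear ha
    induction S using Finset.induction_on with
    | empty => exact ⟨fun _ => c, by simp, by simp, by simp⟩
    | insert m S _ ih =>
      obtain ⟨f, hf⟩ := ih
      obtain ⟨f', -, hf'⟩ := hπ.exists_extension hρ hf m
      exact ⟨f', hf'⟩
  rcases isEmpty_or_nonempty N with hN | hN
  · exact ⟨embeddingOfEdge (fun x => isEmptyElim x) (fun x => isEmptyElim x)
      (fun x => isEmptyElim x)⟩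
  · obtain ⟨f, hf⟩ := key Finset.univ Finset.univ_nonempty
    exact ⟨embeddingOfEdge f (fun x y h => hf.injOn (by simp) (by simp) h)
      fun x y => hf.edge_iff x (by simp) y (by simp)⟩

lemma IsGenericPartition.isUltrahomogeneous {M : Type u} [Language.graph.Structure M]
    [Countable M] {π : M → ι} (hπ : IsGenericPartition π) :
    Language.graph.IsUltrahomogeneous M := by
  classical
  rw [isUltrahomogeneous_iff_IsExtensionPair Structure.cg_of_countable,
    isExtensionPair_iff_exists_embedding_closure_singleton_sup]
  intro S hS f m
  have : Finite S := Substructure.fg_iff_finite.1 hS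
  set T : Finset M := (Set.toFinite (S : Set M)).toFinset with hT
  have hTS : ∀ x, x ∈ T ↔ x ∈ S := fun x => by simp [hT]
  let F : M → M := fun x => if h : x ∈ S then f ⟨x, h⟩ else x
  have hF : ∀ x (h : x ∈ S), F x = f ⟨x, h⟩ := fun x h => dif_pos h
  have hFe : ∀ x ∈ T, ∀ y ∈ T, Edge (F x) (F y) ↔ Edge x y := fun x hx y hy => by
    rw [hF x ((hTS x).1 hx), hF y ((hTS y).1 hy), embedding_edge_iff]
    exact (embedding_edge_iff S.subtype _ _).symm
  -- After relabelling the source partition by `σ`, the partial map preserves labels and the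
  -- one-point extension applies.
  obtain ⟨σ, hσ⟩ := exists_perm_extend T π (π ∘ F) fun x hx y hy =>
    (hπ.toIsPartition.eq_iff hπ.toIsPartition (hFe x hx y hy) (hFe y hy x hx)).symm
  obtain ⟨F', hF', hF'e⟩ := hπ.exists_extension (hπ.toIsPartition.comp_injective σ.injective) (S := T) (f := F)
    ⟨fun x hx y hy h => by
      rw [hF x ((hTS x).1 hx), hF y ((hTS y).1 hy)] at h
      exact congrArg Subtype.val (f.injective h), fun x hx => (hσ x hx).symm, hFe⟩ m
  have hmem : ∀ x : (Substructure.closure Language.graph {m} ⊔ S : Language.graph.Substructure M),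
      (x : M) ∈ insert m T := by
    rintro ⟨x, hx⟩
    have e : Substructure.closure Language.graph {m} ⊔ S =
        Substructure.closure Language.graph ({m} ∪ (S : Set M)) := by
      rw [Substructure.closure_union, Substructure.closure_eq]
    rw [e, ← SetLike.mem_coe, Substructure.closure_eq_of_isRelational] at hx
    simpa [hTS] using hx
  refine ⟨embeddingOfEdge (fun x => F' x)
    (fun x y h => Subtype.ext (hF'e.injOn (hmem x) (hmem y) h))
    (fun x y => (hF'e.edge_iff _ (hmem x) _ (hmem y)).trans
      (embedding_edge_iff (Substructure.subtype _) x y)), ?_⟩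
  ext x
  change f x = F' x
  rw [hF' x ((hTS x).2 x.2), hF x x.2]

lemma IsGenericPartition.isFraisseLimit {M : Type u} [Language.graph.Structure M]
    [Countable M] {π : M → ι} (hπ : IsGenericPartition π) :
    IsFraisseLimit (finitePartiteTournaments ι) M := by
  refine ⟨hπ.isUltrahomogeneous, ?_⟩
  ext N
  constructor
  · rintro ⟨h1, ⟨f⟩⟩
    exact ⟨Structure.fg_iff_finite.1 h1, hπ.toIsPartition.isPartiteTournament.of_embedding f⟩
  · rintro ⟨h1, h2⟩
    obtain ⟨ρ, hρ⟩ := h2.exists_isPartition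
    exact ⟨Structure.fg_iff_finite.2 h1, hπ.nonempty_embedding hρ⟩

variable [Encodable ι]

/-- The edge relation of a generic `ι`-partite tournament on `ι × ℕ`: between elements of
different parts, the orientation is read off from the binary expansion of the second coordinate
of the element with the larger code. -/
def genericEdge (x y : ι × ℕ) : Prop :=
  x.1 ≠ y.1 ∧ (if Encodable.encode x < Encodable.encode y then
    y.2.testBit (Encodable.encode x) = true else ¬ x.2.testBit (Encodable.encode y) = true)

lemma le_encode_prod (x : ι × ℕ) : x.2 ≤ Encodable.encode x := by
  rw [Encodable.encode_prod_val]
  exact Nat.right_le_pair _ _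

lemma exists_testBit_iff (W : Finset ℕ) (N : ℕ) :
    ∃ k, N ≤ k ∧ ∀ j < N, k.testBit j ↔ j ∈ W := by
  -- The summand `2 ^ N` makes the number large without affecting the bits below `N`.
  refine ⟨2 ^ N + Nat.ofBits (fun i : Fin N => decide ((i : ℕ) ∈ W)), ?_, fun j hj => ?_⟩
  · exact Nat.lt_two_pow_self.le.trans (Nat.le_add_right _ _)
  · rw [Nat.testBit_two_pow_add_gt hj, Nat.testBit_ofBits_lt _ _ hj]
    simp

lemma exists_isGenericPartition (ι : Type) [Encodable ι] :
    ∃ (M : Type u) (_ : Language.graph.Structure M) (_ : Countable M) (π : M → ι),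
      IsGenericPartition π := by
  classical
  let _ : Language.graph.Structure (ULift.{u} (ι × ℕ)) :=
    structureOfRel fun x y => genericEdge x.down y.down
  refine ⟨ULift.{u} (ι × ℕ), inferInstance, inferInstance, fun x => x.down.1, ⟨?_, ?_⟩, ?_⟩
  · rintro ⟨x⟩ ⟨y⟩ h h'
    replace h : genericEdge x y := h
    replace h' : genericEdge y x := h'
    obtain ⟨h1, h2⟩ := h
    obtain ⟨-, h3⟩ := h'
    rcases lt_trichotomy (Encodable.encode x) (Encodable.encode y) with hlt | heq | hlt
    · rw [if_pos hlt] at h2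
      rw [if_neg hlt.not_gt] at h3
      exact h3 h2
    · exact h1 (congrArg Prod.fst (Encodable.encode_injective heq))
    · rw [if_neg hlt.not_gt] at h2
      rw [if_pos hlt] at h3
      exact h2 h3
  · rintro ⟨x⟩ ⟨y⟩
    change x.1 ≠ y.1 ↔ genericEdge x y ∨ genericEdge y x
    constructor
    · intro hne
      rcases lt_trichotomy (Encodable.encode x) (Encodable.encode y) with hlt | heq | hlt
      · simp only [genericEdge, if_pos hlt, if_neg hlt.not_gt]
        by_cases hb : y.2.testBit (Encodable.encode x)
        · exact Or.inl ⟨hne, hb⟩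
        · exact Or.inr ⟨hne.symm, hb⟩
      · exact absurd (congrArg Prod.fst (Encodable.encode_injective heq)) hne
      · simp only [genericEdge, if_pos hlt, if_neg hlt.not_gt]
        by_cases hb : x.2.testBit (Encodable.encode y)
        · exact Or.inr ⟨hne.symm, hb⟩
        · exact Or.inl ⟨hne, hb⟩
    · rintro (h | h)
      · exact h.1
      · exact h.1.symm
  · intro i F U V hU hV hdisj
    let code : ULift.{u} (ι × ℕ) → ℕ := fun x => Encodable.encode x.down
    have hcode : Function.Injective code := fun x y h =>
      ULift.ext _ _ (Encodable.encode_injective h)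
    let N := (F ∪ (U ∪ V)).sup code + 1
    have hN : ∀ x ∈ F ∪ (U ∪ V), code x < N := fun x hx => Nat.lt_succ_of_le (Finset.le_sup hx)
    obtain ⟨k, hk, hkb⟩ := exists_testBit_iff (V.image code) N
    -- The witness has a larger code than every given vertex, so it is new and its own bits decide
    -- all the relevant edges.
    have hz : N ≤ code ⟨(i, k)⟩ := hk.trans (le_encode_prod (i, k))
    refine ⟨⟨(i, k)⟩, rfl, fun h => ?_, fun x hx => ?_, fun x hx => ?_⟩
    · exact absurd (hN _ (Finset.mem_union_left _ h)) hz.not_gt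
    · have hlt := hN x (Finset.mem_union_right _ (Finset.mem_union_left _ hx))
      refine ⟨(hU x hx).symm, (if_neg (hlt.trans_le hz).not_gt).mpr ?_⟩
      intro hb
      obtain ⟨y, hy, hyx⟩ := Finset.mem_image.1 ((hkb _ hlt).1 hb)
      rw [hcode hyx] at hy
      exact Finset.disjoint_left.1 hdisj hx hy
    · have hlt := hN x (Finset.mem_union_right _ (Finset.mem_union_right _ hx))
      exact ⟨hV x hx, (if_pos (hlt.trans_le hz)).mpr
        ((hkb _ hlt).2 (Finset.mem_image_of_mem _ hx))⟩

/-- The class of finite `ι`-partite tournaments has a Fraïssé limit. -/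
theorem exists_isFraisseLimit (ι : Type) [Encodable ι] :
    ∃ (M : Type u) (_ : Language.graph.Structure M) (_ : Countable M),
      IsFraisseLimit (finitePartiteTournaments ι) M := by
  obtain ⟨M, hM, hc, π, hπ⟩ := exists_isGenericPartition.{u} ι
  exact ⟨M, hM, hc, hπ.isFraisseLimit⟩

end GenericPartite

/-! ### Extending partial automorphisms by valuations -/

section ExtensionProperty

/-- On `ι × A` parts and vertices can be permuted independently. The pairs `(part a, a)` carry the
given edges; all other orientations are arbitrary and come from a linear order. -/
lemma exists_bool_tournament {ι : Type} {A : Type*} [Language.graph.Structure A] [Finite A]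
    [Finite ι] {part : A → ι} (h : IsPartition part) :
    ∃ t : ι × A → ι × A → Bool, (∀ x y, x ≠ y → t y x = !t x y) ∧
      ∀ a b, part a ≠ part b → (t (part a, a) (part b, b) = true ↔ Edge a b) := by
  classical
  obtain ⟨r, hr⟩ := Countable.exists_injective_nat (ι × A)
  refine ⟨fun x y => if x.1 = part x.2 ∧ y.1 = part y.2 ∧ part x.2 ≠ part y.2 then
    decide (Edge x.2 y.2) else decide (r x < r y), fun x y hxy => ?_, fun a b hab => ?_⟩
  · by_cases hc : x.1 = part x.2 ∧ y.1 = part y.2 ∧ part x.2 ≠ part y.2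
    · have hc' : y.1 = part y.2 ∧ x.1 = part x.2 ∧ part y.2 ≠ part x.2 :=
        ⟨hc.2.1, hc.1, hc.2.2.symm⟩
      simp only [if_pos hc, if_pos hc']
      rcases (h.ne_iff _ _).1 hc.2.2 with he | he
      · simp [he, h.asymm _ _ he]
      · simp [he, h.asymm _ _ he]
    · have hc' : ¬ (y.1 = part y.2 ∧ x.1 = part x.2 ∧ part y.2 ≠ part x.2) :=
        fun hc' => hc ⟨hc'.2.1, hc'.1, hc'.2.2.symm⟩
      simp only [if_neg hc, if_neg hc']
      rcases lt_or_gt_of_ne (hr.ne hxy) with hlt | hlt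
      · simp [hlt, hlt.le]
      · simp [hlt, hlt.le]
  · simp [hab]

variable {X : Type*} {ι : Type} (q : X → ι) (t : X → X → Bool)

/-- Edges between vertices of `X` equipped with valuations: the orientation given by `t` is
flipped according to the two valuations. -/
def valuationEdge (v w : X × (X → Bool)) : Prop :=
  q v.1 ≠ q w.1 ∧ (xor (xor (v.2 w.1) (w.2 v.1)) (t v.1 w.1)) = true

/-- The partite tournament of vertices with valuations. -/
@[reducible] def valuationStructure : Language.graph.Structure (X × (X → Bool)) :=
  structureOfRel (valuationEdge q t)

lemma isPartition_valuation (ht : ∀ x y, x ≠ y → t y x = !t x y) :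
    @IsPartition ι _ (valuationStructure q t) fun v => q v.1 := by
  have hne : ∀ {x y : X}, q x ≠ q y → x ≠ y := fun h e => h (congrArg q e)
  let _ := valuationStructure q t
  refine ⟨?_, ?_⟩
  · rintro ⟨x, χ⟩ ⟨y, ψ⟩ ⟨h1, h2⟩ ⟨-, h3⟩
    change (xor (xor (χ y) (ψ x)) (t x y)) = true at h2
    change (xor (xor (ψ x) (χ y)) (t y x)) = true at h3
    rw [ht x y (hne h1)] at h3
    revert h2 h3
    cases χ y <;> cases ψ x <;> cases t x y <;> decide
  · rintro ⟨x, χ⟩ ⟨y, ψ⟩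
    constructor
    · intro h
      change q x ≠ q y at h
      change valuationEdge q t (x, χ) (y, ψ) ∨ valuationEdge q t (y, ψ) (x, χ)
      simp only [valuationEdge, ne_eq, h, h.symm, not_false_eq_true, true_and,
        ht x y (hne h)]
      cases χ y <;> cases ψ x <;> cases t x y <;> decide
    · rintro (h | h)
      · exact h.1
      · exact h.1.symm

/-- A permutation of the vertices acts on vertices with valuations, twisted by `c`. -/
def valuationPerm (ρ : Equiv.Perm X) (c : X → X → Bool) : Equiv.Perm (X × (X → Bool)) where
  toFun v := (ρ v.1, fun z => xor (v.2 (ρ.symm z)) (c v.1 (ρ.symm z)))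
  invFun v := (ρ.symm v.1, fun y => xor (v.2 (ρ y)) (c (ρ.symm v.1) y))
  left_inv v := by ext <;> simp
  right_inv v := by ext <;> simp

lemma valuationEdge_valuationPerm {ρ : Equiv.Perm X} {c : X → X → Bool}
    (hρ : ∀ x y, q (ρ x) = q (ρ y) ↔ q x = q y)
    (hc : ∀ x y, q x ≠ q y → xor (c x y) (c y x) = xor (t x y) (t (ρ x) (ρ y)))
    (v w : X × (X → Bool)) :
    valuationEdge q t (valuationPerm ρ c v) (valuationPerm ρ c w) ↔ valuationEdge q t v w := by
  obtain ⟨x, χ⟩ := v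
  obtain ⟨y, ψ⟩ := w
  simp only [valuationEdge, valuationPerm, Equiv.coe_fn_mk, Equiv.symm_apply_apply, ne_eq, hρ]
  refine and_congr_right fun h => ?_
  have := hc x y h
  revert this
  cases χ y <;> cases ψ x <;> cases t x y <;> cases t (ρ x) (ρ y) <;> cases c x y <;>
    cases c y x <;> decide

/-- Only the sum of `c x y` and `c y x` is prescribed, so one entry of each pair can carry the whole
correction, chosen outside `D` whenever possible. If both vertices lie in `D`, no correction is
needed. -/
lemma exists_twist [Finite X] (ht : ∀ x y, x ≠ y → t y x = !t x y) (ρ : Equiv.Perm X)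
    (D : Set X) (hD : ∀ x ∈ D, ∀ y ∈ D, q x ≠ q y → t (ρ x) (ρ y) = t x y) :
    ∃ c : X → X → Bool, (∀ x ∈ D, ∀ y, c x y = false) ∧
      ∀ x y, q x ≠ q y → xor (c x y) (c y x) = xor (t x y) (t (ρ x) (ρ y)) := by
  classical
  obtain ⟨r, hr⟩ := Countable.exists_injective_nat X
  refine ⟨fun x y => if x ∈ D then false else if y ∈ D ∨ r x < r y then
    xor (t x y) (t (ρ x) (ρ y)) else false, fun x hx y => if_pos hx, fun x y hxy => ?_⟩
  have hne : x ≠ y := fun e => hxy (congrArg q e)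
  have hsymm : xor (t y x) (t (ρ y) (ρ x)) = xor (t x y) (t (ρ x) (ρ y)) := by
    rw [ht x y hne, ht (ρ x) (ρ y) (ρ.injective.ne hne)]
    simp
  by_cases hx : x ∈ D <;> by_cases hy : y ∈ D
  · simp [hx, hy, hD x hx y hy hxy]
  · simp [hx, hy, hsymm]
  · simp [hx, hy]
  · rcases lt_or_gt_of_ne (hr.ne hne) with hlt | hlt
    · simp [hx, hy, hlt, hlt.not_gt]
    · simp [hx, hy, hlt, hlt.not_gt, hsymm]

/-- The extension property for partial automorphisms of finite partite tournaments. -/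
theorem exists_extension_partial_automorphisms {ι : Type} [Finite ι] {A : Type u}
    [Language.graph.Structure A] [Finite A] {part : A → ι} (h : IsPartition part) :
    ∃ (B : Type u) (_ : Language.graph.Structure B) (_ : Finite B) (partB : B → ι)
      (e : A ↪[Language.graph] B), IsPartition partB ∧
      ∀ (S : Finset A) (p : A → A), Set.InjOn p S →
        (∀ x ∈ S, ∀ y ∈ S, Edge (p x) (p y) ↔ Edge x y) →
        ∃ θ : B ≃[Language.graph] B, ∀ x ∈ S, θ (e x) = e (p x) := by
  obtain ⟨t, ht, htA⟩ := exists_bool_tournament h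
  let X := ι × A
  let q : X → ι := Prod.fst
  let _ : Language.graph.Structure (X × (X → Bool)) := valuationStructure q t
  have hB : IsPartition fun v : X × (X → Bool) => q v.1 := isPartition_valuation q t ht
  let e : A ↪[Language.graph] (X × (X → Bool)) :=
    embeddingOfEdge (fun a => ((part a, a), fun _ => false))
      (fun a b hab => congrArg (fun v : X × (X → Bool) => v.1.2) hab)
      (fun a b => by
        change valuationEdge q t _ _ ↔ _
        simp only [valuationEdge, q]
        constructor
        · rintro ⟨h1, h2⟩
          exact (htA a b h1).1 (by simpa using h2)
        · intro hab
          have hne := (h.ne_iff a b).2 (Or.inl hab)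
          exact ⟨hne, by simpa using (htA a b hne).2 hab⟩)
  refine ⟨X × (X → Bool), inferInstance, inferInstance, fun v => q v.1, e, hB, ?_⟩
  intro S p hp hpe
  have hpart : ∀ x ∈ S, ∀ y ∈ S, part (p x) = part (p y) ↔ part x = part y :=
    fun x hx y hy => h.eq_iff h (hpe x hx y hy) (hpe y hy x hx)
  obtain ⟨σ, hσ⟩ := exists_perm_extend S part (part ∘ p)
    fun x hx y hy => (hpart x hx y hy).symm
  obtain ⟨τ, hτ⟩ := exists_perm_extend S id p
    fun x hx y hy => ⟨fun e => congrArg p e, fun e => hp hx hy e⟩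
  let ρ : Equiv.Perm X := Equiv.prodCongr σ τ
  have hρ : ∀ x ∈ S, ρ (part x, x) = (part (p x), p x) := fun x hx =>
    Prod.ext (hσ x hx) (hτ x hx)
  -- The twist vanishes at the embedded vertices of `S`, so zero valuations there go to zero
  -- valuations and the automorphism extends `p`.
  obtain ⟨c, hc, hct⟩ := exists_twist q t ht ρ ((fun a => (part a, a)) '' (S : Set A)) (by
    rintro _ ⟨x, hx, rfl⟩ _ ⟨y, hy, rfl⟩ hxy
    rw [hρ x hx, hρ y hy, Bool.eq_iff_iff, htA x y hxy,
      htA _ _ (fun e => hxy ((hpart x hx y hy).1 e)), hpe x hx y hy])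
  have hedge := valuationEdge_valuationPerm q t (ρ := ρ) (c := c)
    (fun x y => σ.injective.eq_iff) hct
  refine ⟨⟨valuationPerm ρ c, fun f => isEmptyElim f, fun r v => ?_⟩, fun x hx => ?_⟩
  · exact relMap_comp_iff (f := valuationPerm ρ c) hedge r v
  · refine Prod.ext (hρ x hx) (funext fun z => ?_)
    change xor false (c (part x, x) _) = false
    rw [hc _ ⟨x, hx, rfl⟩]
    rfl

end ExtensionProperty

/-! ### Finite systems inside the limit -/

section Limit

variable {ι : Type} {M : Type u} [Language.graph.Structure M] [Countable M]

lemma exists_isPartition_finset (hM : IsFraisseLimit (finitePartiteTournaments ι) M)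
    (A : Finset M) : ∃ part : A → ι, IsPartition part := by
  have hA : CategoryTheory.Bundled.mk (c := Language.graph.Structure) A inferInstance ∈ Language.graph.age M :=
    ⟨Structure.fg_iff_finite.2 (inferInstanceAs (Finite A)), ⟨finsetEmbedding A⟩⟩
  rw [hM.age] at hA
  exact hA.2.exists_isPartition

lemma exists_embedding_extend (hM : IsFraisseLimit (finitePartiteTournaments ι) M)
    {D : Type u} [Language.graph.Structure D] [Finite D] {part : D → ι} (hD : IsPartition part)
    {C : Finset M} (j : C ↪[Language.graph] D) :
    ∃ f : D ↪[Language.graph] M, ∀ c, f (j c) = c := by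
  have hDM : CategoryTheory.Bundled.mk (c := Language.graph.Structure) D inferInstance ∈ Language.graph.age M := by
    rw [hM.age]
    exact ⟨inferInstanceAs (Finite D), hD.isPartiteTournament⟩
  have : Nonempty (D ↪[Language.graph] M) := hDM.2
  obtain ⟨f, hf⟩ := hM.ultrahomogeneous.extend_embedding Structure.FG.of_finite
    (finsetEmbedding C) j
  exact ⟨f, fun c => (DFunLike.congr_fun hf c).symm⟩

lemma asymm_of_isFraisseLimit (hM : IsFraisseLimit (finitePartiteTournaments ι) M)
    (x y : M) (h : Edge x y) : ¬ Edge y x := by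
  classical
  obtain ⟨part, hp⟩ := exists_isPartition_finset hM {x, y}
  exact hp.asymm ⟨x, by simp⟩ ⟨y, by simp⟩ h

/-- Non-adjacency is an equivalence relation because this can be checked on three-element
substructures; its classes are the parts. -/
lemma exists_isPartition_nat (hM : IsFraisseLimit (finitePartiteTournaments ι) M) :
    ∃ part : M → ℕ, IsPartition part := by
  classical
  let s : Setoid M :=
    { r := fun x y => ¬ (Edge x y ∨ Edge y x)
      iseqv :=
        { refl := fun x h => asymm_of_isFraisseLimit hM x x (h.elim id id) (h.elim id id)
          symm := fun h h' => h h'.symm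
          trans := fun {x y z} h h' => by
            obtain ⟨part, hp⟩ := exists_isPartition_finset hM {x, y, z}
            have h1 := (hp.ne_iff ⟨x, by simp⟩ ⟨y, by simp⟩).not.2 h
            have h2 := (hp.ne_iff ⟨y, by simp⟩ ⟨z, by simp⟩).not.2 h'
            rw [not_not] at h1 h2
            exact (hp.ne_iff ⟨x, by simp⟩ ⟨z, by simp⟩).not.1 (not_not.2 (h1.trans h2)) } }
  obtain ⟨f, hf⟩ := Countable.exists_injective_nat (Quotient s)
  refine ⟨fun x => f ⟦x⟧, asymm_of_isFraisseLimit hM, fun x y => ?_⟩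
  rw [hf.ne_iff, ne_eq, Quotient.eq, not_iff_comm]
  exact Iff.rfl

/-- An embedding of a finite structure with an automorphism into an ultrahomogeneous structure
carries the automorphism to the restriction of an automorphism. -/
lemma exists_aut_comm {L : FirstOrder.Language} {M : Type u} [L.Structure M]
    (hM : L.IsUltrahomogeneous M) {D : Type*} [L.Structure D] [Finite D] (f : D ↪[L] M)
    (θ : D ≃[L] D) : ∃ g : M ≃[L] M, ∀ x, g (f x) = f (θ x) :=
  exists_aut_comp_embedding hM f (f.comp θ.toEmbedding)

lemma extendsToLocallyFinite (hM : IsFraisseLimit (finitePartiteTournaments ℕ) M) (n : ℕ) :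
    ExtendsToLocallyFinite Language.graph M n := by
  classical
  intro g T
  obtain ⟨π, hπ⟩ := exists_isPartition_nat hM
  let A : Finset M := T ∪ Finset.univ.biUnion fun i => T.image (g i)
  have hTA : T ⊆ A := Finset.subset_union_left
  have hgA : ∀ i, ∀ x ∈ T, g i x ∈ A := fun i x hx => Finset.mem_union_right _
    (Finset.mem_biUnion.2 ⟨i, Finset.mem_univ i, Finset.mem_image_of_mem _ hx⟩)
  -- The extension property needs finitely many parts, so only those met by `A` are kept.
  let part : A → Set.range (fun a : A => π a) := fun a => ⟨π a, a, rfl⟩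
  have hpart : IsPartition part := ⟨fun x y => hπ.asymm (x : M) y, fun x y =>
    (not_congr Subtype.ext_iff).trans (hπ.ne_iff (x : M) y)⟩
  obtain ⟨B, _, _, partB, e, hB, hθ⟩ := exists_extension_partial_automorphisms hpart
  obtain ⟨f, hf⟩ := exists_embedding_extend hM (hB.comp_injective Subtype.coe_injective) e
  have hg : ∀ i, ∃ g' : M ≃[Language.graph] M, (∀ x ∈ T, g' x = g i x) ∧
      ∀ b, ∃ b', g' (f b) = f b' := by
    intro i
    let p : A → A := fun x => if h : (x : M) ∈ T then ⟨g i x, hgA i x h⟩ else x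
    have hp : ∀ x : A, (x : M) ∈ T → (p x : M) = g i x := fun x h => by
      simp only [p, dif_pos h]
    obtain ⟨θ, hθ⟩ := hθ (Finset.univ.filter fun x : A => (x : M) ∈ T) p
      (fun x hx y hy h => by
        simp only [Finset.coe_filter, Finset.mem_univ, true_and, Set.mem_ofPred_eq] at hx hy
        have := congrArg Subtype.val h
        rw [hp x hx, hp y hy] at this
        exact Subtype.ext ((g i).injective this))
      (fun x hx y hy => by
        simp only [Finset.mem_filter, Finset.mem_univ, true_and] at hx hy
        rw [edge_finset, edge_finset, hp x hx, hp y hy, aut_edge_iff])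
    obtain ⟨g', hg'⟩ := exists_aut_comm hM.ultrahomogeneous f θ
    refine ⟨g', fun x hx => ?_, fun b => ⟨_, hg' b⟩⟩
    have h1 := hg' (e ⟨x, hTA hx⟩)
    rw [hf, hθ _ (by simpa using hx), hf, hp _ hx] at h1
    exact h1
  choose g' hg'T hg'f using hg
  have := Fintype.ofFinite B
  refine ⟨g', Finset.univ.image f, hg'T, fun x hx => ?_, fun i y hy => ?_⟩
  · exact Finset.mem_image.2 ⟨e ⟨x, hTA hx⟩, Finset.mem_univ _, hf _⟩
  · obtain ⟨b, -, rfl⟩ := Finset.mem_image.1 hy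
    obtain ⟨b', hb'⟩ := hg'f i b
    exact Finset.mem_image.2 ⟨b', Finset.mem_univ _, hb'.symm⟩

end Limit

/-! ### Canonical amalgamation with fresh parts -/

section AmalgamationOfSystems

lemma IsInvariant.apply_mem_iff {L : FirstOrder.Language} {M : Type u} [L.Structure M] {n : ℕ}
    {g : Fin n → (M ≃[L] M)} {A : Finset M} (h : IsInvariant g A) (i : Fin n) (x : M) :
    g i x ∈ A ↔ x ∈ A := by
  refine ⟨fun hx => ?_, h i x⟩
  obtain ⟨y, hy, hyx⟩ := Finset.surj_on_of_inj_on_of_card_le (fun a _ => g i a)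
    (fun a ha => h i a ha) (fun _ _ _ _ e => (g i).injective e) le_rfl (g i x) hx
  rwa [(g i).injective hyx]

variable {M : Type u} {ι : Type} (p : M → ι) (A B C : Finset M)

/-- Two elements lie in a common part that meets `A`. -/
def SamePartOver (b c : M) : Prop := ∃ a ∈ A, p b = p a ∧ p a = p c

/-- The common witness in `A` is moved to the same element by `β` and `g`, and automorphisms respect
parts. -/
lemma samePartOver_aut_iff [Language.graph.Structure M] {p : M → ι} {A : Finset M}
    (hp : IsPartition p)
    {β g : M ≃[Language.graph] M} (hA : ∀ x, β x ∈ A ↔ x ∈ A) (hβ : ∀ x ∈ A, g x = β x) (b c : M) :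
    SamePartOver p A (β b) (g c) ↔ SamePartOver p A b c := by
  have hpaut : ∀ (f : M ≃[Language.graph] M) (x y : M), p (f x) = p (f y) ↔ p x = p y :=
    fun f x y => hp.eq_iff hp (aut_edge_iff f x y) (aut_edge_iff f y x)
  constructor
  · rintro ⟨a, ha, h1, h2⟩
    obtain ⟨a, rfl⟩ := β.surjective a
    have ha' := (hA a).1 ha
    refine ⟨a, ha', (hpaut β b a).1 h1, ?_⟩
    rw [← hβ a ha'] at h2
    exact (hpaut g a c).1 h2
  · rintro ⟨a, ha, h1, h2⟩
    refine ⟨β a, (hA a).2 ha, (hpaut β b a).2 h1, ?_⟩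
    rw [← hβ a ha]
    exact (hpaut g a c).2 h2

variable [DecidableEq M]

open Classical in
/-- The partition of the amalgam: the parts of `B` and `C` meeting `A` are identified. -/
noncomputable def amalgamPart : B ⊕ (C \ A : Finset M) → ι ⊕ ι
  | .inl b => .inl (p b)
  | .inr c => if ∃ a ∈ A, p a = p c then .inl (p c) else .inr (p c)

lemma amalgamPart_inl_eq_inr_iff (b : B) (c : (C \ A : Finset M)) :
    amalgamPart p A B C (.inl b) = amalgamPart p A B C (.inr c) ↔ SamePartOver p A b c := by
  by_cases h : ∃ a ∈ A, p a = p c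
  · simp only [amalgamPart, if_pos h, Sum.inl.injEq]
    constructor
    · intro e
      obtain ⟨a, ha, hac⟩ := h
      exact ⟨a, ha, e.trans hac.symm, hac⟩
    · rintro ⟨a, -, h1, h2⟩
      exact h1.trans h2
  · simp only [amalgamPart, if_neg h, reduceCtorEq, false_iff]
    rintro ⟨a, ha, -, h2⟩
    exact h ⟨a, ha, h2⟩

lemma amalgamPart_inr_eq_inr_iff (c c' : (C \ A : Finset M)) :
    amalgamPart p A B C (.inr c) = amalgamPart p A B C (.inr c') ↔ p c = p c' := by
  constructor
  · simp only [amalgamPart]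
    split_ifs <;> simp
  · intro e
    simp only [amalgamPart]
    rw [e]

/-- The inclusion of `C` into the amalgam of `B` and `C` over `A`. -/
def amalgamIncl {A B C : Finset M} (hAB : A ⊆ B) (c : C) : B ⊕ (C \ A : Finset M) :=
  if h : (c : M) ∈ A then .inl ⟨c, hAB h⟩ else .inr ⟨c, Finset.mem_sdiff.2 ⟨c.2, h⟩⟩

lemma amalgamIncl_injective {A B C : Finset M} (hAB : A ⊆ B) :
    Function.Injective (amalgamIncl (C := C) hAB) := by
  intro c c' h
  unfold amalgamIncl at h
  split_ifs at h
  · exact Subtype.ext (Subtype.mk.inj (Sum.inl.inj h))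
  · exact Subtype.ext (Subtype.mk.inj (Sum.inr.inj h))

variable [Language.graph.Structure M]

/-- The edge relation on the amalgam of `B` and `C` over `A`: all new edges go from `B` to `C`. -/
def amalgamEdge : B ⊕ (C \ A : Finset M) → B ⊕ (C \ A : Finset M) → Prop
  | .inl b, .inl b' => Edge (b : M) b'
  | .inr c, .inr c' => Edge (c : M) c'
  | .inl b, .inr c => if (b : M) ∈ A then Edge (b : M) c else ¬ SamePartOver p A b c
  | .inr c, .inl b => (b : M) ∈ A ∧ Edge (c : M) b

/-- The amalgam of `B` and `C` over `A`. -/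
@[reducible] def amalgamStructure : Language.graph.Structure (B ⊕ (C \ A : Finset M)) :=
  structureOfRel (amalgamEdge p A B C)

lemma isPartition_amalgam {p : M → ι} (hp : IsPartition p) :
    @IsPartition (ι ⊕ ι) _ (amalgamStructure p A B C) (amalgamPart p A B C) := by
  have hmem : ∀ {b c : M}, b ∈ A → (SamePartOver p A b c ↔ p b = p c) := fun {b c} hb =>
    ⟨fun ⟨_, _, h1, h2⟩ => h1.trans h2, fun e => ⟨b, hb, rfl, e⟩⟩
  have hcross : ∀ (b : B) (c : (C \ A : Finset M)),
      amalgamPart p A B C (.inl b) ≠ amalgamPart p A B C (.inr c) ↔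
        amalgamEdge p A B C (.inl b) (.inr c) ∨ amalgamEdge p A B C (.inr c) (.inl b) := by
    intro b c
    rw [ne_eq, amalgamPart_inl_eq_inr_iff]
    by_cases hb : (b : M) ∈ A
    · simp only [amalgamEdge, hb, if_true, true_and, hmem hb]
      exact hp.ne_iff _ _
    · simp [amalgamEdge, hb]
  let _ := amalgamStructure p A B C
  refine ⟨?_, ?_⟩
  · have hasymm : ∀ (b : B) (c : (C \ A : Finset M)),
        amalgamEdge p A B C (.inl b) (.inr c) → ¬ amalgamEdge p A B C (.inr c) (.inl b) := by
      rintro b c h ⟨hb, h'⟩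
      simp only [amalgamEdge, hb, if_true] at h
      exact hp.asymm _ _ h h'
    rintro (b | c) (b' | c') h h'
    · exact hp.asymm (b : M) b' h h'
    · exact hasymm _ _ h h'
    · exact hasymm _ _ h' h
    · exact hp.asymm (c : M) c' h h'
  · rintro (b | c) (b' | c')
    · exact Sum.inl_injective.ne_iff.trans (hp.ne_iff (b : M) b')
    · exact hcross b c'
    · exact ne_comm.trans ((hcross b' c).trans or_comm)
    · exact (not_congr (amalgamPart_inr_eq_inr_iff p A B C c c')).trans (hp.ne_iff (c : M) c')

variable {p A B C}

lemma amalgamEdge_sumMap (hp : IsPartition p) {β g : M ≃[Language.graph] M}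
    (hA : ∀ x, β x ∈ A ↔ x ∈ A) (hβ : ∀ x ∈ A, g x = β x) (β' : B → B)
    (hβ' : ∀ b, (β' b : M) = β b) (g' : (C \ A : Finset M) → (C \ A : Finset M))
    (hg' : ∀ c, (g' c : M) = g c) (x y : B ⊕ (C \ A : Finset M)) :
    amalgamEdge p A B C (Sum.map β' g' x) (Sum.map β' g' y) ↔ amalgamEdge p A B C x y := by
  rcases x with b | c <;> rcases y with b' | c'
  · simp only [amalgamEdge, Sum.map_inl, hβ']
    exact aut_edge_iff β _ _
  · simp only [amalgamEdge, Sum.map_inl, Sum.map_inr, hβ', hg', hA]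
    by_cases hb : (b : M) ∈ A
    · rw [if_pos hb, if_pos hb, ← hβ _ hb]
      exact aut_edge_iff g _ _
    · rw [if_neg hb, if_neg hb, samePartOver_aut_iff hp hA hβ]
  · simp only [amalgamEdge, Sum.map_inl, Sum.map_inr, hβ', hg', hA]
    refine and_congr_right fun hb => ?_
    rw [← hβ _ hb]
    exact aut_edge_iff g _ _
  · simp only [amalgamEdge, Sum.map_inr, hg']
    exact aut_edge_iff g _ _

lemma amalgamEdge_incl (hAB : A ⊆ B) (c c' : C) :
    amalgamEdge p A B C (amalgamIncl hAB c) (amalgamIncl hAB c') ↔ Edge (c : M) c' := by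
  unfold amalgamIncl
  split_ifs with h h' h' <;> simp [amalgamEdge, h, h']

lemma amalgamatesSystems [Countable M] (hM : IsFraisseLimit (finitePartiteTournaments ℕ) M)
    (n : ℕ) : AmalgamatesSystems Language.graph M n := by
  intro g β A B C hAB hAC hβA hβB hgC hgβ
  obtain ⟨p, hp⟩ := exists_isPartition_nat hM
  have hgA : IsInvariant g A := fun i x hx => by rw [hgβ i x hx]; exact hβA i x hx
  let _ : Language.graph.Structure (B ⊕ (C \ A : Finset M)) := amalgamStructure p A B C
  let j : C ↪[Language.graph] (B ⊕ (C \ A : Finset M)) :=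
    embeddingOfEdge (amalgamIncl hAB) (amalgamIncl_injective hAB) (amalgamEdge_incl hAB)
  -- Here infinitely many parts are essential: the amalgam has parts in `ℕ ⊕ ℕ`, which is again
  -- indexed by `ℕ`.
  obtain ⟨f, hf⟩ := exists_embedding_extend hM ((isPartition_amalgam A B C hp).comp_injective
    (Equiv.natSumNatEquivNat).injective) j
  let βB : Fin n → Equiv.Perm B := fun i =>
    (β i).toEquiv.subtypeEquiv fun x => (hβB.apply_mem_iff i x).symm
  let gC : Fin n → Equiv.Perm (C \ A : Finset M) := fun i =>
    (g i).toEquiv.subtypeEquiv fun x => by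
      change x ∈ C \ A ↔ g i x ∈ C \ A
      rw [Finset.mem_sdiff, Finset.mem_sdiff, hgC.apply_mem_iff, hgA.apply_mem_iff]
  let θ : Fin n → ((B ⊕ (C \ A : Finset M)) ≃[Language.graph] (B ⊕ (C \ A : Finset M))) :=
    fun i => ⟨Equiv.sumCongr (βB i) (gC i), fun f => isEmptyElim f, fun r v =>
      relMap_comp_iff (f := Sum.map (βB i) (gC i)) (amalgamEdge_sumMap hp
        (hβA.apply_mem_iff i) (hgβ i) (βB i) (fun _ => rfl) (gC i) fun _ => rfl) r v⟩
  choose g' hg' using fun i => exists_aut_comm hM.ultrahomogeneous f (θ i)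
  -- Homogeneity moves `B` to its copy in the embedded amalgam; this `φ` is the realization.
  obtain ⟨φ, hφ⟩ := exists_aut_comp_embedding hM.ultrahomogeneous (finsetEmbedding B)
    (f.comp (embeddingOfEdge Sum.inl Sum.inl_injective fun _ _ => Iff.rfl))
  have hφ' : ∀ b : B, φ b = f (.inl b) := hφ
  refine ⟨g', fun i x hx => ?_, φ, fun x hx => ?_, fun i x hx => ?_⟩
  · have hθj : θ i (j ⟨x, hx⟩) = j ⟨g i x, hgC i x hx⟩ := by
      change Sum.map (βB i) (gC i) (amalgamIncl hAB _) = amalgamIncl hAB _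
      unfold amalgamIncl
      by_cases hxA : x ∈ A
      · rw [dif_pos hxA, dif_pos (hgA i x hxA)]
        exact congrArg Sum.inl (Subtype.ext (hgβ i x hxA).symm)
      · rw [dif_neg hxA, dif_neg (fun h => hxA ((hgA.apply_mem_iff i x).1 h))]
        rfl
    have := hg' i (j ⟨x, hx⟩)
    rwa [hθj, hf, hf] at this
  · have hj : j ⟨x, hAC hx⟩ = .inl ⟨x, hAB hx⟩ := dif_pos hx
    have := hf ⟨x, hAC hx⟩
    rw [hj] at this
    exact (hφ' ⟨x, hAB hx⟩).trans this
  · rw [hφ' ⟨x, hx⟩, hg' i (.inl ⟨x, hx⟩)]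
    exact hφ' ⟨β i x, hβB i x hx⟩

end AmalgamationOfSystems

/-! ### No dense conjugacy class for finitely many parts -/

section FinitelyManyParts

/-- The transitive tournament on `Fin n`. -/
@[reducible] def transitiveTournament (n : ℕ) : Language.graph.Structure (ULift.{u} (Fin n)) :=
  structureOfRel fun i j => i.down < j.down

lemma isPartition_transitiveTournament (n : ℕ) :
    @IsPartition (Fin n) _ (transitiveTournament.{u} n) ULift.down := by
  let _ := transitiveTournament.{u} n
  exact ⟨fun i j h h' => lt_asymm (show i.down < j.down from h) h', fun i j => ne_iff_lt_or_gt⟩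

variable {M : Type u} [Language.graph.Structure M] [Countable M] {n : ℕ}

lemma exists_transversal (hM : IsFraisseLimit (finitePartiteTournaments (Fin n)) M)
    {p : M → ℕ} (hp : IsPartition p) :
    ∃ f : Fin n → M, (∀ i j, p (f i) = p (f j) → i = j) ∧ ∀ x, ∃ i, p (f i) = p x := by
  classical
  let _ := transitiveTournament.{u} n
  have hD := isPartition_transitiveTournament.{u} n
  let j : (∅ : Finset M) ↪[Language.graph] ULift.{u} (Fin n) :=
    embeddingOfEdge (fun x => absurd x.2 (Finset.notMem_empty _))
      (fun x => absurd x.2 (Finset.notMem_empty _)) (fun x => absurd x.2 (Finset.notMem_empty _))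
  obtain ⟨f, -⟩ := exists_embedding_extend hM hD j
  have hf : ∀ i j : Fin n, p (f ⟨i⟩) = p (f ⟨j⟩) ↔ i = j := fun i j =>
    hD.eq_iff hp (embedding_edge_iff f ⟨i⟩ ⟨j⟩) (embedding_edge_iff f ⟨j⟩ ⟨i⟩)
  refine ⟨fun i => f ⟨i⟩, fun i j => (hf i j).1, fun x => ?_⟩
  let T : Finset M := insert x (Finset.univ.image fun i : Fin n => f ⟨i⟩)
  obtain ⟨part, hpart⟩ := exists_isPartition_finset hM T
  have hpp : ∀ y z : T, p y = p z ↔ part y = part z := fun y z =>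
    hpart.eq_iff hp Iff.rfl Iff.rfl
  let v : Fin n → T := fun i => ⟨f ⟨i⟩, Finset.mem_insert_of_mem
    (Finset.mem_image_of_mem (fun i : Fin n => f ⟨i⟩) (Finset.mem_univ i))⟩
  -- The `n` vertices already occupy all `n` labels available for `T`, so `x` shares a part with one
  -- of them.
  have hinj : Function.Injective (part ∘ v) := fun i j h => (hf i j).1 ((hpp (v i) (v j)).2 h)
  obtain ⟨i, hi⟩ := Finite.surjective_of_injective hinj (part ⟨x, Finset.mem_insert_self _ _⟩)
  exact ⟨i, (hpp (v i) ⟨x, Finset.mem_insert_self _ _⟩).2 hi⟩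

lemma isOpen_setOf_apply_mem {L : FirstOrder.Language} {M : Type u} [L.Structure M] (x : M)
    (S : Set M) : IsOpen {g : M ≃[L] M | g x ∈ S} := by
  have : {g : M ≃[L] M | g x ∈ S} = ⋃ y ∈ S, {g | g x = y} := by ext; simp
  rw [this]
  exact isOpen_biUnion fun y _ => isOpen_setOf_apply_eq x y

/-- The automorphisms preserving every part form a clopen conjugation invariant set. -/
theorem not_hasDenseConjClass (hn : 2 ≤ n)
    (hM : IsFraisseLimit (finitePartiteTournaments (Fin n)) M) :
    ¬ HasDenseConjClass (M ≃[Language.graph] M) := by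
  rintro ⟨g, hg⟩
  obtain ⟨p, hp⟩ := exists_isPartition_nat hM
  obtain ⟨f, hf, hfp⟩ := exists_transversal hM hp
  have hpaut : ∀ (c : M ≃[Language.graph] M) (x y : M), p (c x) = p (c y) ↔ p x = p y :=
    fun c x y => hp.eq_iff hp (aut_edge_iff c x y) (aut_edge_iff c y x)
  have hconj : ∀ a b : M ≃[Language.graph] M, IsConj a b → (∀ x, p (a x) = p x) →
      ∀ x, p (b x) = p x := by
    intro a b hab ha x
    obtain ⟨c, rfl⟩ := isConj_iff.1 hab
    have h := (hpaut c _ _).2 (ha (c⁻¹ x))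
    rwa [aut_apply_inv_self] at h
  let x₀ := f ⟨0, by omega⟩
  let x₁ := f ⟨1, by omega⟩
  have hne : p x₁ ≠ p x₀ := fun h => by simpa using hf _ _ h
  let _ : Language.graph.Structure PUnit.{u + 1} := structureOfRel fun _ _ => False
  let e : M → (PUnit.{u + 1} ↪[Language.graph] M) := fun x =>
    embeddingOfEdge (fun _ => x) (fun _ _ _ => rfl)
      fun _ _ => iff_of_false (hp.irrefl x) id
  obtain ⟨s, hs⟩ := exists_aut_comp_embedding hM.ultrahomogeneous (e x₀) (e x₁)
  have hs' : s x₀ = x₁ := hs PUnit.unit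
  obtain ⟨a, ha, hga⟩ := hg.inter_open_nonempty {g | g x₀ ∈ {y | p y ≠ p x₀}}
    (isOpen_setOf_apply_mem x₀ _) ⟨s, by simpa [hs'] using hne⟩
  -- Finitely many representatives detect whether all parts are preserved, so this is an open
  -- condition, satisfied by the identity.
  obtain ⟨b, hb, hgb⟩ := hg.inter_open_nonempty (⋂ i, {g | g (f i) ∈ {y | p y = p (f i)}})
    (isOpen_iInter_of_finite fun i => isOpen_setOf_apply_mem (f i) _) ⟨1, by simp⟩
  refine ha (hconj b a ?_ ?_ x₀)
  · exact (show IsConj g b from hgb).symm.trans hga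
  · intro x
    obtain ⟨i, hi⟩ := hfp x
    have h : p (b (f i)) = p (f i) := Set.mem_iInter.1 hb i
    rw [← hi, ← h, hpaut, hi]

/-- Comeagre sets are dense by Baire category, and the projection from one-tuples maps the orbit
into a conjugacy class. -/
lemma HasGenericAutomorphisms.hasDenseConjClass {L : FirstOrder.Language} {M : Type u}
    [L.Structure M] [Countable M] (h : HasGenericAutomorphisms L M 1) :
    HasDenseConjClass (M ≃[L] M) := by
  obtain ⟨g, hg⟩ := h
  refine ⟨g 0, ?_⟩
  have hsurj : Function.Surjective fun f : Fin 1 → (M ≃[L] M) => f 0 :=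
    fun a => ⟨fun _ => a, rfl⟩
  refine (hsurj.denseRange.dense_image (continuous_apply 0) (dense_of_mem_residual hg)).mono ?_
  rintro _ ⟨_, ⟨c, rfl⟩, rfl⟩
  exact isConj_iff.2 ⟨c, rfl⟩

end FinitelyManyParts

end PartiteTournament

open FirstOrder PartiteTournament in
theorem theorem1p4 :
    ((∃ (M : Type u) (_ : Language.graph.Structure M) (_ : Countable M),
        Language.IsFraisseLimit (finitePartiteTournaments ℕ) M) ∧
      ∀ (M : Type u) [Language.graph.Structure M] [Countable M],
        Language.IsFraisseLimit (finitePartiteTournaments ℕ) M →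
          HasAmpleGenerics Language.graph M) ∧
    ∀ n : ℕ, 2 ≤ n →
      (∃ (M : Type u) (_ : Language.graph.Structure M) (_ : Countable M),
        Language.IsFraisseLimit (finitePartiteTournaments (Fin n)) M) ∧
      ∀ (M : Type u) [Language.graph.Structure M] [Countable M],
        Language.IsFraisseLimit (finitePartiteTournaments (Fin n)) M →
          ¬ HasGenericAutomorphisms Language.graph M 1 ∧
          ¬ HasDenseConjClass (M ≃[Language.graph] M) := by
  classical
  refine ⟨⟨exists_isFraisseLimit ℕ, fun M _ _ hM n _ => ?_⟩, fun n hn =>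
    ⟨exists_isFraisseLimit (Fin n), fun M _ _ hM => ?_⟩⟩
  · exact hasGenericAutomorphisms_of_amalgamatesSystems (extendsToLocallyFinite hM n)
      (amalgamatesSystems hM n)
  · have h := not_hasDenseConjClass hn hM
    exact ⟨fun hg => h hg.hasDenseConjClass, h⟩
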